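/- A cotree is a rooted binary tree in which every nonleaf node has a left and a right child and is either a union node or a join node, and every leaf carries a graph consisting of a single vertex, distinct leaves carrying distinct vertices. It defines a graph at each of its nodes: at a leaf, the given one-vertex graph; at a union node, the disjoint union of the graphs at its two children; at a join node, the disjoint union of the graphs at its two children together with all edges between them. A finite simple graph $G$ is a cograph if it is the graph at the root of some cotree. For a finite simple graph $G$ and an integer $k$, let $\mathrm{TAR}_k(G)$ be the graph whose vertices are the independent sets of $G$ of size at least $k$, two distinct independent sets $I$ and $J$ being adjacent if there is a vertex $v\in V(G)$ with $I\cup\{v\}=J$ or $I=J\cup\{v\}$. Corollary. Let $G$ be a cograph on $n$ vertices and let $k$ be an integer. Then every connected component of $\mathrm{TAR}_k(G)$ has (finite) diameter at most $4n-2k$. -/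

import Mathlib

universe u

/-- Rooted ordered binary trees whose leaves carry elements of `V` (trivial leaves: the graph at a
leaf consists of that single vertex) and whose nonleaf nodes, each with a left and a right child,
are partitioned into union nodes and join nodes. -/
inductive Cotree (V : Type u) : Type u
  | leaf (v : V) : Cotree V
  | union (l r : Cotree V) : Cotree V
  | join (l r : Cotree V) : Cotree V

namespace Cotree

variable {V : Type u}

/-- The vertex set of the graph at the root of the tree. -/
def verts : Cotree V → Set V
  | leaf v => {v}
  | union l r => l.verts ∪ r.verts
  | join l r => l.verts ∪ r.verts

/-- The graphs at distinct leaves are vertex disjoint: at every nonleaf node the two children have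
disjoint vertex sets. -/
def VertexDisjoint : Cotree V → Prop
  | leaf _ => True
  | union l r => l.VertexDisjoint ∧ r.VertexDisjoint ∧ Disjoint l.verts r.verts
  | join l r => l.VertexDisjoint ∧ r.VertexDisjoint ∧ Disjoint l.verts r.verts

/-- The edges of the graph at the root of the tree: none at a leaf, those of both children at a
union node, and in addition all edges between the two children at a join node. It is recorded as a
graph on the ambient type `V`, where the elements outside `verts` are isolated. -/
def graph : Cotree V → SimpleGraph V
  | leaf _ => ⊥
  | union l r => l.graph ⊔ r.graph
  | join l r => l.graph ⊔ r.graph ⊔ SimpleGraph.fromRel (fun y z => y ∈ l.verts ∧ z ∈ r.verts)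

/-- `T` is a cotree for the graph `G` with vertex set `V`. -/
def IsCotreeFor (T : Cotree V) (G : SimpleGraph V) : Prop :=
  T.VertexDisjoint ∧ T.verts = Set.univ ∧ T.graph = G

end Cotree

namespace SimpleGraph

variable {V : Type u}

/-- A graph is a cograph if there exists a cotree for it. -/
def IsCograph (G : SimpleGraph V) : Prop :=
  ∃ T : Cotree V, T.IsCotreeFor G

/-- The finite independent sets of `G` with at least `k` elements. -/
abbrev TARVertex (G : SimpleGraph V) (k : ℤ) : Type u :=
  {I : Finset V // G.IsIndepSet (I : Set V) ∧ k ≤ (I.card : ℤ)}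

/-- The token addition and removal graph `TAR_k(G)`: its vertices are the independent sets of `G`
of size at least `k`, and two distinct ones are adjacent if one is obtained from the other by
adding a single vertex. -/
def TAR [DecidableEq V] (G : SimpleGraph V) (k : ℤ) : SimpleGraph (G.TARVertex k) where
  Adj I J := I ≠ J ∧ ∃ v : V, I.1 ∪ {v} = J.1 ∨ I.1 = J.1 ∪ {v}
  symm := ⟨fun _ _ h => ⟨h.1.symm, h.2.imp fun _ hv => hv.symm.imp Eq.symm Eq.symm⟩⟩
  loopless := ⟨fun _ h => h.1 rfl⟩

end SimpleGraph

/-!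
Independent sets of a cograph are reconfigured by descending along a potential `ψ` with
`#I ≤ ψ I ≤ 2 * n - #I` which does not depend on `k`: every component of the reconfiguration graph,
for every `k`, has a sink `S` of maximum size such that each `I` in it reaches `S` in at most
`ψ I - ψ S` steps. Two sets `I` and `J` in a component are then joined through the sink in at most
`ψ I + ψ J - 2 * ψ S ≤ 4 * n - 4 * k` steps.

At a union node the potentials of the children are added. Descending alternately in the two children
ends in a set whose two parts are both sinks; as sinks have maximum size, the part of any reachable
set in one child stays within the component of that sink, so this set is unique. At a join node
every independent set lies in one child and, for `k > 0`, cannot leave it. For `k = 0` everything is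
connected, and the sink of the child with the larger independent sets absorbs those of the other
child once their potential is raised by twice the number of vertices of the former.
-/

open Finset
open scoped SetFamily

variable {V : Type u}

section TokenGraph

/-- The reconfiguration graph of a family `F` of finite sets under the addition and removal of
single elements, all sets having at least `k` elements. It is a graph on all of `Finset V`, in which
the sets that are not in `F` or too small are isolated. -/
def tokenGraph (F : Set (Finset V)) (k : ℕ) : SimpleGraph (Finset V) where
  Adj I J := (I ∈ F ∧ k ≤ #I) ∧ (J ∈ F ∧ k ≤ #J) ∧ (SimpleGraph.hasse (Finset V)).Adj I J
  symm := ⟨fun _ _ h => ⟨h.2.1, h.1, h.2.2.symm⟩⟩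
  loopless := ⟨fun _ h => h.2.2.ne rfl⟩

variable {F G : Set (Finset V)} {k : ℕ} {I J : Finset V}

theorem tokenGraph_mono (hFG : F ⊆ G) : tokenGraph F k ≤ tokenGraph G k :=
  fun _ _ h => ⟨⟨hFG h.1.1, h.1.2⟩, ⟨hFG h.2.1.1, h.2.1.2⟩, h.2.2⟩

theorem subset_or_subset_of_tokenGraph_adj (h : (tokenGraph F k).Adj I J) : I ⊆ J ∨ J ⊆ I :=
  h.2.2.imp CovBy.le CovBy.le

theorem mem_and_le_card_of_reachable (h : (tokenGraph F k).Reachable I J)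
    (hI : I ∈ F ∧ k ≤ #I) : J ∈ F ∧ k ≤ #J := by
  obtain ⟨w⟩ := h
  induction w with
  | nil => exact hI
  | cons hadj _ ih => exact ih hadj.2.1

theorem exists_walk_of_subset (hF : IsLowerSet F) (hJ : J ∈ F) (hIJ : I ⊆ J) (hk : k ≤ #I) :
    ∃ w : (tokenGraph F k).Walk I J, w.length + #I = #J := by
  classical
  induction J using Finset.strongInduction with
  | H J ih =>
    obtain rfl | hne := hIJ.eq_or_ssubset
    · exact ⟨.nil, by simp⟩
    obtain ⟨v, hvJ, hvI⟩ := Finset.exists_of_ssubset hne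
    have hsub : I ⊆ J.erase v := Finset.subset_erase.2 ⟨hIJ, hvI⟩
    have hmem : J.erase v ∈ F := hF (Finset.erase_subset v J) hJ
    obtain ⟨w, hw⟩ := ih _ (Finset.erase_ssubset hvJ) hmem hsub
    have hadj : (tokenGraph F k).Adj (J.erase v) J :=
      ⟨⟨hmem, hk.trans (card_le_card hsub)⟩, ⟨hJ, hk.trans (card_le_card hIJ)⟩,
        .inl (covBy_iff_exists_erase.2 ⟨v, hvJ, rfl⟩)⟩
    refine ⟨w.concat hadj, ?_⟩
    rw [SimpleGraph.Walk.length_concat, ← card_erase_add_one hvJ]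
    omega

theorem reachable_of_subset_or_subset (hF : IsLowerSet F) (hI : I ∈ F) (hJ : J ∈ F) (hkI : k ≤ #I)
    (hkJ : k ≤ #J) (h : I ⊆ J ∨ J ⊆ I) : (tokenGraph F k).Reachable I J := by
  rcases h with h | h
  · exact (exists_walk_of_subset hF hJ h hkI).choose.reachable
  · exact (exists_walk_of_subset hF hI h hkJ).choose.reachable.symm

theorem exists_walk_length_eq_card_add_card (hF : IsLowerSet F) (hI : I ∈ F) (hJ : J ∈ F) :
    ∃ w : (tokenGraph F 0).Walk I J, w.length = #I + #J := by
  obtain ⟨p, hp⟩ := exists_walk_of_subset (k := 0) hF hI (empty_subset I) (Nat.zero_le _)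
  obtain ⟨q, hq⟩ := exists_walk_of_subset (k := 0) hF hJ (empty_subset J) (Nat.zero_le _)
  refine ⟨p.reverse.append q, ?_⟩
  rw [SimpleGraph.Walk.length_append, SimpleGraph.Walk.length_reverse]
  simpa using congrArg₂ (· + ·) hp hq

theorem reachable_of_reachable_union (hFG : ∀ A ∈ F, ∀ B ∈ G, Disjoint A B) (hk : 0 < k)
    (hI : I ∈ F) (h : (tokenGraph (F ∪ G) k).Reachable I J) : (tokenGraph F k).Reachable I J := by
  obtain ⟨w⟩ := h
  induction w with
  | nil => exact .rfl
  | @cons I K _ hadj _ ih =>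
    have hne : ∀ {A : Finset V}, k ≤ #A → A ≠ ∅ := fun hA => card_pos.1 (hk.trans_le hA) |>.ne_empty
    have hK : K ∈ F := by
      refine hadj.2.1.1.resolve_right fun hK => ?_
      rcases subset_or_subset_of_tokenGraph_adj hadj with hIK | hKI
      · exact hne hadj.1.2 ((hFG I hI K hK).eq_bot_of_le hIK)
      · exact hne hadj.2.1.2 ((hFG I hI K hK).eq_bot_of_ge hKI)
    have hIK : (tokenGraph F k).Adj I K := ⟨⟨hI, hadj.1.2⟩, ⟨hK, hadj.2.1.2⟩, hadj.2.2⟩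
    exact hIK.reachable.trans (ih hK)

end TokenGraph

section Potential

/-- `I` can be reconfigured into `J` in at most as many steps as the potential `ψ` drops. -/
def TokenDescends (F : Set (Finset V)) (k : ℕ) (ψ : Finset V → ℕ) (I J : Finset V) : Prop :=
  ∃ w : (tokenGraph F k).Walk I J, w.length + ψ J ≤ ψ I

/-- `S` is a sink of its component of the reconfiguration graph: a set of maximum size to which
every set in the component descends. -/
structure IsTokenSink (F : Set (Finset V)) (k : ℕ) (ψ : Finset V → ℕ) (S : Finset V) : Prop where
  descends : ∀ I, (tokenGraph F k).Reachable I S → TokenDescends F k ψ I S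
  card_le : ∀ I, (tokenGraph F k).Reachable I S → #I ≤ #S

/-- `ψ` is a potential for reconfiguring the members of `F`, which is thought of as a family of
subsets of a ground set with `n` elements. The same `ψ` serves every size bound `k`. -/
structure IsTokenPotential (F : Set (Finset V)) (n : ℕ) (ψ : Finset V → ℕ) : Prop where
  card_le : ∀ I ∈ F, #I ≤ ψ I
  add_card_le : ∀ I ∈ F, ψ I + #I ≤ 2 * n
  exists_sink : ∀ k, ∀ I ∈ F, k ≤ #I → ∃ S, (tokenGraph F k).Reachable I S ∧ IsTokenSink F k ψ S

variable {F G : Set (Finset V)} {k m n : ℕ} {ψ φ : Finset V → ℕ} {I J K S T : Finset V}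

namespace TokenDescends

theorem reachable (h : TokenDescends F k ψ I J) : (tokenGraph F k).Reachable I J :=
  h.choose.reachable

theorem le (h : TokenDescends F k ψ I J) : ψ J ≤ ψ I := by
  obtain ⟨w, hw⟩ := h
  omega

theorem eq_of_le (h : TokenDescends F k ψ I J) (hIJ : ψ I ≤ ψ J) : I = J := by
  obtain ⟨w, hw⟩ := h
  exact w.eq_of_length_eq_zero (by omega)

theorem trans (hIJ : TokenDescends F k ψ I J) (hJK : TokenDescends F k ψ J K) :
    TokenDescends F k ψ I K := by
  obtain ⟨p, hp⟩ := hIJ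
  obtain ⟨q, hq⟩ := hJK
  exact ⟨p.append q, by rw [SimpleGraph.Walk.length_append]; omega⟩

theorem mono (hFG : F ⊆ G) (hψφ : ψ I + φ J ≤ φ I + ψ J) (h : TokenDescends F k ψ I J) :
    TokenDescends G k φ I J := by
  obtain ⟨w, hw⟩ := h
  exact ⟨w.mapLe (tokenGraph_mono hFG), by rw [SimpleGraph.Walk.length_mapLe]; omega⟩

end TokenDescends

theorem exists_tokenDescends_forall_eq (F : Set (Finset V)) (k : ℕ) (ψ : Finset V → ℕ)
    (I : Finset V) :
    ∃ J, TokenDescends F k ψ I J ∧ ∀ K, TokenDescends F k ψ J K → J = K := by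
  obtain ⟨J, hIJ, hmin⟩ := exists_minimalFor_of_wellFoundedLT (TokenDescends F k ψ I) ψ
    ⟨I, .nil, by simp⟩
  exact ⟨J, hIJ, fun K hJK => hJK.eq_of_le (hmin (hIJ.trans hJK) hJK.le)⟩

theorem IsTokenSink.eq_of_reachable (hS : IsTokenSink F k ψ S) (hT : IsTokenSink F k ψ T)
    (h : (tokenGraph F k).Reachable S T) : S = T :=
  (hT.descends S h).eq_of_le (hS.descends T h.symm).le

theorem IsTokenPotential.exists_walk_length_add_le (hψ : IsTokenPotential F n ψ) (hI : I ∈ F)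
    (hk : k ≤ #I) (h : (tokenGraph F k).Reachable I J) :
    ∃ w : (tokenGraph F k).Walk I J, w.length + #I + #J + 2 * k ≤ 4 * n := by
  obtain ⟨S, hIS, hS⟩ := hψ.exists_sink k I hI hk
  obtain ⟨p, hp⟩ := hS.descends I hIS
  obtain ⟨q, hq⟩ := hS.descends J (h.symm.trans hIS)
  have hSF := mem_and_le_card_of_reachable hIS ⟨hI, hk⟩
  have hψS := hψ.card_le S hSF.1
  have hψI := hψ.add_card_le I hI
  have hψJ := hψ.add_card_le J (mem_and_le_card_of_reachable h ⟨hI, hk⟩).1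
  refine ⟨p.append q.reverse, ?_⟩
  rw [SimpleGraph.Walk.length_append, SimpleGraph.Walk.length_reverse]
  omega

theorem isTokenPotential_Iic (X : Finset V) :
    IsTokenPotential (Set.Iic X) #X (fun I => 2 * #X - #I) where
  card_le I hI := by
    have := card_le_card (Set.mem_Iic.1 hI)
    omega
  add_card_le I hI := by
    have := card_le_card (Set.mem_Iic.1 hI)
    omega
  exists_sink k I hI hk := by
    have hkX : k ≤ #X := hk.trans (card_le_card hI)
    have hmem : ∀ J, (tokenGraph (Set.Iic X) k).Reachable J X → J ⊆ X ∧ k ≤ #J := fun J hJ =>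
      mem_and_le_card_of_reachable hJ.symm ⟨Set.self_mem_Iic, hkX⟩
    have hwalk : ∀ J, J ⊆ X → k ≤ #J →
        ∃ w : (tokenGraph (Set.Iic X) k).Walk J X, w.length + #J = #X := fun J hJ =>
      exists_walk_of_subset (isLowerSet_Iic X) Set.self_mem_Iic hJ
    refine ⟨X, (hwalk I hI hk).choose.reachable, fun J hJ => ?_, fun J hJ =>
      card_le_card (hmem J hJ).1⟩
    obtain ⟨w, hw⟩ := hwalk J (hmem J hJ).1 (hmem J hJ).2
    exact ⟨w, by dsimp only; omega⟩

end Potential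

section Union

variable {F G : Set (Finset V)} {k m n : ℕ} {ψ φ : Finset V → ℕ} {S : Finset V}

open Classical in
/-- The potential on `F ∪ G` that extends `ψ` on `F` and raises `φ` by `2 * m` on the rest, `m`
being the size of the ground set of `F`. -/
noncomputable def raisedPotential (F : Set (Finset V)) (m : ℕ) (ψ φ : Finset V → ℕ)
    (I : Finset V) : ℕ :=
  if I ∈ F then ψ I else φ I + 2 * m

theorem IsTokenSink.union_left (hFG : ∀ A ∈ F, ∀ B ∈ G, Disjoint A B) (hk : 0 < k)
    (hSF : S ∈ F) (hkS : k ≤ #S) (hS : IsTokenSink F k ψ S) :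
    IsTokenSink (F ∪ G) k (raisedPotential F m ψ φ) S := by
  have hreach : ∀ I, (tokenGraph (F ∪ G) k).Reachable I S → (tokenGraph F k).Reachable I S :=
    fun I hI => (reachable_of_reachable_union hFG hk hSF hI.symm).symm
  refine ⟨fun I hI => ?_, fun I hI => hS.card_le I (hreach I hI)⟩
  have hIF : I ∈ F := (mem_and_le_card_of_reachable (hreach I hI).symm ⟨hSF, hkS⟩).1
  refine (hS.descends I (hreach I hI)).mono Set.subset_union_left ?_
  rw [raisedPotential, raisedPotential, if_pos hIF, if_pos hSF, add_comm]

theorem IsTokenSink.union_right (hFG : ∀ A ∈ F, ∀ B ∈ G, Disjoint A B) (hk : 0 < k)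
    (hSG : S ∈ G) (hkS : k ≤ #S) (hS : IsTokenSink G k φ S) :
    IsTokenSink (F ∪ G) k (raisedPotential F m ψ φ) S := by
  have hreach : ∀ I, (tokenGraph (F ∪ G) k).Reachable I S → (tokenGraph G k).Reachable I S :=
    fun I hI => (reachable_of_reachable_union (fun B hB A hA => (hFG A hA B hB).symm) hk hSG
      (Set.union_comm F G ▸ hI.symm)).symm
  have hnot : ∀ I, (tokenGraph G k).Reachable I S → I ∉ F := fun I hI hIF => by
    obtain ⟨hIG, hkI⟩ := mem_and_le_card_of_reachable hI.symm ⟨hSG, hkS⟩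
    exact (card_pos.1 (hk.trans_le hkI)).ne_empty (disjoint_self.1 (hFG I hIF I hIG))
  refine ⟨fun I hI => ?_, fun I hI => hS.card_le I (hreach I hI)⟩
  refine (hS.descends I (hreach I hI)).mono Set.subset_union_right ?_
  rw [raisedPotential, raisedPotential, if_neg (hnot I (hreach I hI)), if_neg (hnot S .rfl)]
  omega

theorem IsTokenSink.union_zero (hF : IsLowerSet F) (hG : IsLowerSet G)
    (hψ : IsTokenPotential F m ψ) (hφ : IsTokenPotential G n φ)
    (hmax : ∀ B ∈ G, ∃ A ∈ F, #B ≤ #A) (hSF : S ∈ F) (hS : IsTokenSink F 0 ψ S) :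
    IsTokenSink (F ∪ G) 0 (raisedPotential F m ψ φ) S := by
  have hreach : ∀ A ∈ F, (tokenGraph F 0).Reachable A S := fun A hA =>
    (exists_walk_length_eq_card_add_card hF hA hSF).choose.reachable
  have hmem : ∀ I, (tokenGraph (F ∪ G) 0).Reachable I S → I ∈ F ∪ G := fun I hI =>
    (mem_and_le_card_of_reachable hI.symm ⟨Set.mem_union_left G hSF, Nat.zero_le _⟩).1
  refine ⟨fun I hI => ?_, fun I hI => ?_⟩
  · by_cases hIF : I ∈ F
    · refine (hS.descends I (hreach I hIF)).mono Set.subset_union_left ?_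
      rw [raisedPotential, raisedPotential, if_pos hIF, if_pos hSF, add_comm]
    · obtain ⟨w, hw⟩ := exists_walk_length_eq_card_add_card (hF.union hG) (hmem I hI)
        (Set.mem_union_left G hSF)
      have hφI := hφ.card_le I ((hmem I hI).resolve_left hIF)
      have hψS := hψ.add_card_le S hSF
      refine ⟨w, ?_⟩
      rw [raisedPotential, raisedPotential, if_neg hIF, if_pos hSF]
      omega
  · rcases hmem I hI with hIF | hIG
    · exact hS.card_le I (hreach I hIF)
    · obtain ⟨A, hA, hIA⟩ := hmax I hIG
      exact hIA.trans (hS.card_le A (hreach A hA))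

theorem IsTokenPotential.union (hF : IsLowerSet F) (hG : IsLowerSet G)
    (hFG : ∀ A ∈ F, ∀ B ∈ G, Disjoint A B) (hmax : ∀ B ∈ G, ∃ A ∈ F, #B ≤ #A)
    (hψ : IsTokenPotential F m ψ) (hφ : IsTokenPotential G n φ) :
    IsTokenPotential (F ∪ G) (m + n) (raisedPotential F m ψ φ) where
  card_le I hI := by
    rw [raisedPotential]
    split_ifs with hIF
    · exact hψ.card_le I hIF
    · exact (hφ.card_le I (hI.resolve_left hIF)).trans (Nat.le_add_right _ _)
  add_card_le I hI := by
    rw [raisedPotential]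
    split_ifs with hIF
    · have := hψ.add_card_le I hIF
      omega
    · have := hφ.add_card_le I (hI.resolve_left hIF)
      omega
  exists_sink k I hI hk := by
    rcases k.eq_zero_or_pos with rfl | hpos
    · obtain ⟨A, hA⟩ : F.Nonempty :=
        hI.elim (fun h => ⟨I, h⟩) fun h => (hmax I h).imp fun _ => And.left
      obtain ⟨S, hAS, hS⟩ := hψ.exists_sink 0 A hA (Nat.zero_le _)
      have hSF := (mem_and_le_card_of_reachable hAS ⟨hA, Nat.zero_le _⟩).1
      exact ⟨S, (exists_walk_length_eq_card_add_card (hF.union hG) hI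
        (Set.mem_union_left G hSF)).choose.reachable, hS.union_zero hF hG hψ hφ hmax hSF⟩
    · rcases hI with hI | hI
      · obtain ⟨S, hIS, hS⟩ := hψ.exists_sink k I hI hk
        obtain ⟨hSF, hkS⟩ := mem_and_le_card_of_reachable hIS ⟨hI, hk⟩
        exact ⟨S, hIS.mono (tokenGraph_mono Set.subset_union_left),
          hS.union_left hFG hpos hSF hkS⟩
      · obtain ⟨S, hIS, hS⟩ := hφ.exists_sink k I hI hk
        obtain ⟨hSG, hkS⟩ := mem_and_le_card_of_reachable hIS ⟨hI, hk⟩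
        exact ⟨S, hIS.mono (tokenGraph_mono Set.subset_union_right),
          hS.union_right hFG hpos hSG hkS⟩

theorem exists_isTokenPotential_union (hF : IsLowerSet F) (hG : IsLowerSet G)
    (hFG : ∀ A ∈ F, ∀ B ∈ G, Disjoint A B) (hψ : IsTokenPotential F m ψ)
    (hφ : IsTokenPotential G n φ) : ∃ χ, IsTokenPotential (F ∪ G) (m + n) χ := by
  by_cases hmax : ∀ B ∈ G, ∃ A ∈ F, #B ≤ #A
  · exact ⟨_, hψ.union hF hG hFG hmax hφ⟩
  · push Not at hmax
    obtain ⟨B, hB, hlt⟩ := hmax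
    rw [Set.union_comm, add_comm]
    exact ⟨_, hφ.union hG hF (fun B hB A hA => (hFG A hA B hB).symm)
      (fun A hA => ⟨B, hB, (hlt A hA).le⟩) hψ⟩

end Union

section Sups

variable [DecidableEq V] {F G : Set (Finset V)} {X Y : Finset V} {k l m n : ℕ}
  {ψ φ : Finset V → ℕ} {A A' B B' I J : Finset V}

theorem union_inter_eq_left (hXY : Disjoint X Y) (hA : A ⊆ X) (hB : B ⊆ Y) :
    (A ∪ B) ∩ X = A := by
  rw [union_inter_distrib_right, inter_eq_left.2 hA,
    disjoint_iff_inter_eq_empty.1 (hXY.symm.mono_left hB), union_empty]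

theorem union_inter_eq_right (hXY : Disjoint X Y) (hA : A ⊆ X) (hB : B ⊆ Y) :
    (A ∪ B) ∩ Y = B := by
  rw [union_comm, union_inter_eq_left hXY.symm hB hA]

theorem inter_mem_and_card_add_card_of_mem_sups (hFX : F ⊆ Set.Iic X) (hGY : G ⊆ Set.Iic Y)
    (hXY : Disjoint X Y) (hI : I ∈ F ⊻ G) :
    I ∩ X ∈ F ∧ I ∩ Y ∈ G ∧ #(I ∩ X) + #(I ∩ Y) = #I := by
  obtain ⟨A, hA, B, hB, rfl⟩ := Set.mem_sups.1 hI
  rw [sup_eq_union, union_inter_eq_left hXY (hFX hA) (hGY hB),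
    union_inter_eq_right hXY (hFX hA) (hGY hB)]
  exact ⟨hA, hB, (card_union_of_disjoint (hXY.mono (hFX hA) (hGY hB))).symm⟩

theorem tokenGraph_adj_union_right (hFX : F ⊆ Set.Iic X) (hGY : G ⊆ Set.Iic Y)
    (hXY : Disjoint X Y) (hB : B ∈ G) (h : (tokenGraph F (k - #B)).Adj A A') :
    (tokenGraph (F ⊻ G) k).Adj (A ∪ B) (A' ∪ B) := by
  have hdisj : ∀ {S}, S ∈ F → Disjoint S B := fun hS => hXY.mono (hFX hS) (hGY hB)
  have hmem : ∀ {S}, S ∈ F ∧ k - #B ≤ #S → S ∪ B ∈ F ⊻ G ∧ k ≤ #(S ∪ B) := fun hS =>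
    ⟨Set.sup_mem_sups hS.1 hB, by rw [card_union_of_disjoint (hdisj hS.1)]; omega⟩
  have hcov : ∀ {S T}, T ∈ F → S ⋖ T → S ∪ B ⋖ T ∪ B := by
    intro S T hT hST
    obtain ⟨v, hvS, rfl⟩ := covBy_iff_exists_insert.1 hST
    have hvB : v ∉ B := disjoint_left.1 (hdisj hT) (mem_insert_self v S)
    exact covBy_iff_exists_insert.2 ⟨v, by simp [hvS, hvB], (insert_union v S B).symm⟩
  exact ⟨hmem h.1, hmem h.2.1, h.2.2.imp (hcov h.2.1.1) (hcov h.1.1)⟩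

/-- The potential on `F ⊻ G`, for families `F` on `X` and `G` on `Y`, that adds up the potentials of
the two parts of a set. -/
def sumPotential (X Y : Finset V) (ψ φ : Finset V → ℕ) (I : Finset V) : ℕ :=
  ψ (I ∩ X) + φ (I ∩ Y)

theorem sumPotential_comm (X Y : Finset V) (ψ φ : Finset V → ℕ) :
    sumPotential X Y ψ φ = sumPotential Y X φ ψ :=
  funext fun _ => add_comm _ _

theorem sumPotential_union (hXY : Disjoint X Y) (hA : A ⊆ X) (hB : B ⊆ Y) :
    sumPotential X Y ψ φ (A ∪ B) = ψ A + φ B := by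
  rw [sumPotential, union_inter_eq_left hXY hA hB, union_inter_eq_right hXY hA hB]

theorem TokenDescends.union_right (hFX : F ⊆ Set.Iic X) (hGY : G ⊆ Set.Iic Y)
    (hXY : Disjoint X Y) (hA : A ∈ F) (hB : B ∈ G) (hk : k ≤ #A + #B)
    (h : TokenDescends F (k - #B) ψ A A') :
    TokenDescends (F ⊻ G) k (sumPotential X Y ψ φ) (A ∪ B) (A' ∪ B) := by
  have hA' := (mem_and_le_card_of_reachable h.reachable ⟨hA, by omega⟩).1
  obtain ⟨w, hw⟩ := h
  let addB : tokenGraph F (k - #B) →g tokenGraph (F ⊻ G) k :=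
    ⟨(· ∪ B), tokenGraph_adj_union_right hFX hGY hXY hB⟩
  refine ⟨w.map addB, ?_⟩
  rw [SimpleGraph.Walk.length_map, sumPotential_union hXY (hFX hA) (hGY hB),
    sumPotential_union hXY (hFX hA') (hGY hB)]
  omega

/-- `A` and `B` are sinks for `F` and for `G`, each with respect to the size bound that the other
set leaves for it when the two together shall have at least `k` elements. -/
structure IsTokenSinkPair (F G : Set (Finset V)) (k : ℕ) (ψ φ : Finset V → ℕ)
    (A B : Finset V) : Prop where
  mem_left : A ∈ F
  mem_right : B ∈ G
  left : IsTokenSink F (k - #B) ψ A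
  right : IsTokenSink G (k - #A) φ B

theorem isTokenSink_of_forall_eq (hFX : F ⊆ Set.Iic X) (hGY : G ⊆ Set.Iic Y)
    (hXY : Disjoint X Y) (hψ : IsTokenPotential F m ψ) (hA : A ∈ F) (hB : B ∈ G)
    (hk : k ≤ #A + #B)
    (hstuck : ∀ J, TokenDescends (F ⊻ G) k (sumPotential X Y ψ φ) (A ∪ B) J → A ∪ B = J) :
    IsTokenSink F (k - #B) ψ A := by
  have hkA : k - #B ≤ #A := by omega
  obtain ⟨S, hAS, hS⟩ := hψ.exists_sink (k - #B) A hA hkA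
  have hSF := (mem_and_le_card_of_reachable hAS ⟨hA, hkA⟩).1
  have hunion : A ∪ B = S ∪ B := hstuck _ ((hS.descends A hAS).union_right hFX hGY hXY hA hB hk)
  rwa [← union_inter_eq_left hXY (hFX hA) (hGY hB), hunion,
    union_inter_eq_left hXY (hFX hSF) (hGY hB)]

theorem exists_isTokenSinkPair (hFX : F ⊆ Set.Iic X) (hGY : G ⊆ Set.Iic Y) (hXY : Disjoint X Y)
    (hψ : IsTokenPotential F m ψ) (hφ : IsTokenPotential G n φ) (hI : I ∈ F ⊻ G) (hk : k ≤ #I) :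
    ∃ A B, IsTokenSinkPair F G k ψ φ A B ∧
      TokenDescends (F ⊻ G) k (sumPotential X Y ψ φ) I (A ∪ B) := by
  obtain ⟨J, hIJ, hstuck⟩ := exists_tokenDescends_forall_eq (F ⊻ G) k (sumPotential X Y ψ φ) I
  obtain ⟨hJ, hkJ⟩ := mem_and_le_card_of_reachable hIJ.reachable ⟨hI, hk⟩
  obtain ⟨A, hA, B, hB, rfl⟩ := Set.mem_sups.1 hJ
  rw [sup_eq_union] at hIJ hstuck hkJ
  rw [card_union_of_disjoint (hXY.mono (hFX hA) (hGY hB))] at hkJ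
  refine ⟨A, B, ⟨hA, hB, isTokenSink_of_forall_eq hFX hGY hXY hψ hA hB hkJ hstuck, ?_⟩, hIJ⟩
  rw [Set.sups_comm, sumPotential_comm, union_comm] at hstuck
  exact isTokenSink_of_forall_eq hGY hFX hXY.symm hφ hB hA (by omega) hstuck

theorem reachable_inter_of_tokenGraph_adj (hF : IsLowerSet F) (hFX : F ⊆ Set.Iic X)
    (hGY : G ⊆ Set.Iic Y) (hXY : Disjoint X Y) (h : (tokenGraph (F ⊻ G) k).Adj I J)
    (hl : #(J ∩ Y) ≤ l) : (tokenGraph F (k - l)).Reachable (I ∩ X) (J ∩ X) := by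
  obtain ⟨hIX, -, hcardI⟩ := inter_mem_and_card_add_card_of_mem_sups hFX hGY hXY h.1.1
  obtain ⟨hJX, -, hcardJ⟩ := inter_mem_and_card_add_card_of_mem_sups hFX hGY hXY h.2.1.1
  have hkI := h.1.2
  have hkJ := h.2.1.2
  have hcomp := subset_or_subset_of_tokenGraph_adj h
  have hkIX : k - l ≤ #(I ∩ X) := by
    rcases hcomp with hIJ | hJI
    · have := card_le_card (inter_subset_inter_right hIJ : I ∩ Y ⊆ J ∩ Y)
      omega
    · have := card_le_card (inter_subset_inter_right hJI : J ∩ X ⊆ I ∩ X)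
      omega
  exact reachable_of_subset_or_subset hF hIX hJX hkIX (by omega)
    (hcomp.imp inter_subset_inter_right inter_subset_inter_right)

namespace IsTokenSinkPair

theorem reachable_inter (hF : IsLowerSet F) (hG : IsLowerSet G) (hFX : F ⊆ Set.Iic X)
    (hGY : G ⊆ Set.Iic Y) (hXY : Disjoint X Y) (hAB : IsTokenSinkPair F G k ψ φ A B)
    (h : (tokenGraph (F ⊻ G) k).Reachable I (A ∪ B)) :
    (tokenGraph F (k - #B)).Reachable (I ∩ X) A ∧
      (tokenGraph G (k - #A)).Reachable (I ∩ Y) B := by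
  obtain ⟨w⟩ := h
  generalize hS : A ∪ B = S at w
  induction w with
  | nil =>
    subst hS
    rw [union_inter_eq_left hXY (hFX hAB.mem_left) (hGY hAB.mem_right),
      union_inter_eq_right hXY (hFX hAB.mem_left) (hGY hAB.mem_right)]
    exact ⟨.rfl, .rfl⟩
  | cons hadj _ ih =>
    obtain ⟨hX, hY⟩ := ih hS
    refine ⟨(reachable_inter_of_tokenGraph_adj hF hFX hGY hXY hadj
      (hAB.right.card_le _ hY)).trans hX, ?_⟩
    rw [Set.sups_comm] at hadj
    exact (reachable_inter_of_tokenGraph_adj hG hGY hFX hXY.symm hadj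
      (hAB.left.card_le _ hX)).trans hY

theorem union_eq_of_reachable (hF : IsLowerSet F) (hG : IsLowerSet G) (hFX : F ⊆ Set.Iic X)
    (hGY : G ⊆ Set.Iic Y) (hXY : Disjoint X Y) (hAB : IsTokenSinkPair F G k ψ φ A B)
    (hAB' : IsTokenSinkPair F G k ψ φ A' B')
    (h : (tokenGraph (F ⊻ G) k).Reachable (A ∪ B) (A' ∪ B')) : A ∪ B = A' ∪ B' := by
  obtain ⟨hA, hB⟩ := hAB'.reachable_inter hF hG hFX hGY hXY h
  obtain ⟨hA', hB'⟩ := hAB.reachable_inter hF hG hFX hGY hXY h.symm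
  rw [union_inter_eq_left hXY (hFX hAB.mem_left) (hGY hAB.mem_right)] at hA
  rw [union_inter_eq_right hXY (hFX hAB.mem_left) (hGY hAB.mem_right)] at hB
  rw [union_inter_eq_left hXY (hFX hAB'.mem_left) (hGY hAB'.mem_right)] at hA'
  rw [union_inter_eq_right hXY (hFX hAB'.mem_left) (hGY hAB'.mem_right)] at hB'
  have hcardA : #A = #A' := (hAB'.left.card_le _ hA).antisymm (hAB.left.card_le _ hA')
  have hcardB : #B = #B' := (hAB'.right.card_le _ hB).antisymm (hAB.right.card_le _ hB')
  rw [← hcardB] at hA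
  rw [← hcardA] at hB
  rw [hAB.left.eq_of_reachable (hcardB ▸ hAB'.left) hA,
    hAB.right.eq_of_reachable (hcardA ▸ hAB'.right) hB]

theorem isTokenSink (hF : IsLowerSet F) (hG : IsLowerSet G) (hFX : F ⊆ Set.Iic X)
    (hGY : G ⊆ Set.Iic Y) (hXY : Disjoint X Y) (hψ : IsTokenPotential F m ψ)
    (hφ : IsTokenPotential G n φ) (hk : k ≤ #A + #B) (hAB : IsTokenSinkPair F G k ψ φ A B) :
    IsTokenSink (F ⊻ G) k (sumPotential X Y ψ φ) (A ∪ B) := by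
  have hcard := card_union_of_disjoint
    (hXY.mono (hFX hAB.mem_left) (hGY hAB.mem_right))
  have hmem : ∀ I, (tokenGraph (F ⊻ G) k).Reachable I (A ∪ B) → I ∈ F ⊻ G ∧ k ≤ #I :=
    fun I hI => mem_and_le_card_of_reachable hI.symm
      ⟨Set.sup_mem_sups hAB.mem_left hAB.mem_right, hk.trans_eq hcard.symm⟩
  refine ⟨fun I hI => ?_, fun I hI => ?_⟩
  · obtain ⟨A', B', hAB', hdesc⟩ :=
      exists_isTokenSinkPair hFX hGY hXY hψ hφ (hmem I hI).1 (hmem I hI).2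
    rwa [hAB.union_eq_of_reachable hF hG hFX hGY hXY hAB' (hI.symm.trans hdesc.reachable)]
  · obtain ⟨hX, hY⟩ := hAB.reachable_inter hF hG hFX hGY hXY hI
    obtain ⟨-, -, hcardI⟩ := inter_mem_and_card_add_card_of_mem_sups hFX hGY hXY (hmem I hI).1
    rw [← hcardI, hcard]
    exact add_le_add (hAB.left.card_le _ hX) (hAB.right.card_le _ hY)

end IsTokenSinkPair

theorem IsTokenPotential.sups (hF : IsLowerSet F) (hG : IsLowerSet G) (hFX : F ⊆ Set.Iic X)
    (hGY : G ⊆ Set.Iic Y) (hXY : Disjoint X Y) (hψ : IsTokenPotential F m ψ)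
    (hφ : IsTokenPotential G n φ) :
    IsTokenPotential (F ⊻ G) (m + n) (sumPotential X Y ψ φ) where
  card_le I hI := by
    obtain ⟨hX, hY, hcard⟩ := inter_mem_and_card_add_card_of_mem_sups hFX hGY hXY hI
    exact hcard.symm.trans_le (add_le_add (hψ.card_le _ hX) (hφ.card_le _ hY))
  add_card_le I hI := by
    obtain ⟨hX, hY, hcard⟩ := inter_mem_and_card_add_card_of_mem_sups hFX hGY hXY hI
    have := hψ.add_card_le _ hX
    have := hφ.add_card_le _ hY
    rw [sumPotential]
    omega
  exists_sink k I hI hk := by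
    obtain ⟨A, B, hAB, hdesc⟩ := exists_isTokenSinkPair hFX hGY hXY hψ hφ hI hk
    have hkAB := (mem_and_le_card_of_reachable hdesc.reachable ⟨hI, hk⟩).2
    rw [card_union_of_disjoint (hXY.mono (hFX hAB.mem_left) (hGY hAB.mem_right))] at hkAB
    exact ⟨A ∪ B, hdesc.reachable, hAB.isTokenSink hF hG hFX hGY hXY hψ hφ hkAB⟩

end Sups

namespace Cotree

variable [DecidableEq V] {T l r : Cotree V} {u v : V}

/-- `Cotree.verts` as a finset. -/
def leaves : Cotree V → Finset V
  | leaf v => {v}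
  | union l r => l.leaves ∪ r.leaves
  | join l r => l.leaves ∪ r.leaves

/-- The independent sets of the graph at the root of the tree, in which the elements of `V` outside
`leaves` do not count as vertices. -/
def indepSets (T : Cotree V) : Set (Finset V) :=
  {I | I ⊆ T.leaves ∧ T.graph.IsIndepSet (I : Set V)}

theorem coe_leaves (T : Cotree V) : (T.leaves : Set V) = T.verts := by
  induction T with
  | leaf v => exact coe_singleton v
  | union l r hl hr => rw [leaves, coe_union, hl, hr, verts]
  | join l r hl hr => rw [leaves, coe_union, hl, hr, verts]

theorem mem_verts_iff : v ∈ T.verts ↔ v ∈ T.leaves := by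
  rw [← coe_leaves, mem_coe]

theorem disjoint_verts_iff : Disjoint l.verts r.verts ↔ Disjoint l.leaves r.leaves := by
  rw [← coe_leaves, ← coe_leaves, disjoint_coe]

theorem graph_join_adj : (join l r).graph.Adj u v ↔ l.graph.Adj u v ∨ r.graph.Adj u v ∨
    u ≠ v ∧ (u ∈ l.leaves ∧ v ∈ r.leaves ∨ v ∈ l.leaves ∧ u ∈ r.leaves) := by
  simp only [graph, SimpleGraph.sup_adj, SimpleGraph.fromRel_adj, mem_verts_iff, or_assoc]

theorem mem_leaves_of_graph_adj (h : T.graph.Adj u v) : u ∈ T.leaves := by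
  induction T with
  | leaf w => exact h.elim
  | union l r hl hr => exact mem_union.2 (h.imp hl hr)
  | join l r hl hr =>
    obtain h | h | ⟨-, h | h⟩ := graph_join_adj.1 h
    · exact mem_union_left _ (hl h)
    · exact mem_union_right _ (hr h)
    · exact mem_union_left _ h.1
    · exact mem_union_right _ h.2

theorem isLowerSet_indepSets (T : Cotree V) : IsLowerSet T.indepSets :=
  fun _ _ hJI hI => ⟨hJI.trans hI.1, hI.2.mono (coe_subset.2 hJI)⟩

theorem indepSets_subset_Iic (T : Cotree V) : T.indepSets ⊆ Set.Iic T.leaves :=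
  fun _ hI => hI.1

theorem indepSets_leaf (v : V) : (leaf v).indepSets = Set.Iic {v} :=
  Set.ext fun _ => and_iff_left fun _ _ _ _ _ => not_false

theorem indepSets_union (h : Disjoint l.leaves r.leaves) :
    (union l r).indepSets = l.indepSets ⊻ r.indepSets := by
  ext I
  rw [Set.mem_sups]
  constructor
  · rintro ⟨hsub, hI⟩
    refine ⟨I ∩ l.leaves, ⟨inter_subset_right, fun a ha b hb hab hadj => ?_⟩, I ∩ r.leaves,
      ⟨inter_subset_right, fun a ha b hb hab hadj => ?_⟩, ?_⟩
    · exact hI (mem_of_mem_inter_left ha) (mem_of_mem_inter_left hb) hab (Or.inl hadj)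
    · exact hI (mem_of_mem_inter_left ha) (mem_of_mem_inter_left hb) hab (Or.inr hadj)
    · rw [sup_eq_union, ← inter_union_distrib_left]
      exact inter_eq_left.2 hsub
  · rintro ⟨A, ⟨hAl, hA⟩, B, ⟨hBr, hB⟩, rfl⟩
    have mem_A : ∀ {a}, a ∈ A ∪ B → a ∈ l.leaves → a ∈ A := fun ha hal =>
      (mem_union.1 ha).resolve_right fun hb => disjoint_left.1 h hal (hBr hb)
    have mem_B : ∀ {b}, b ∈ A ∪ B → b ∈ r.leaves → b ∈ B := fun hb hbr =>
      (mem_union.1 hb).resolve_left fun ha => disjoint_left.1 h (hAl ha) hbr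
    refine ⟨union_subset_union hAl hBr, fun a ha b hb hab => ?_⟩
    rintro (hadj | hadj)
    · exact hA (mem_A ha (mem_leaves_of_graph_adj hadj))
        (mem_A hb (mem_leaves_of_graph_adj hadj.symm)) hab hadj
    · exact hB (mem_B ha (mem_leaves_of_graph_adj hadj))
        (mem_B hb (mem_leaves_of_graph_adj hadj.symm)) hab hadj

theorem indepSets_join (h : Disjoint l.leaves r.leaves) :
    (join l r).indepSets = l.indepSets ∪ r.indepSets := by
  ext I
  constructor
  · rintro ⟨hsub, hI⟩
    have hside : I ⊆ l.leaves ∨ I ⊆ r.leaves := by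
      by_contra! hnot
      obtain ⟨a, ha, hal⟩ := not_subset.1 hnot.1
      obtain ⟨b, hb, hbr⟩ := not_subset.1 hnot.2
      have har := (mem_union.1 (hsub ha)).resolve_left hal
      have hbl := (mem_union.1 (hsub hb)).resolve_right hbr
      have hba : b ≠ a := ne_of_mem_of_not_mem hbl hal
      exact hI hb ha hba (graph_join_adj.2 (.inr (.inr ⟨hba, .inl ⟨hbl, har⟩⟩)))
    refine hside.imp (fun hl => ⟨hl, fun a ha b hb hab hadj => ?_⟩)
      fun hr => ⟨hr, fun a ha b hb hab hadj => ?_⟩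
    · exact hI ha hb hab (graph_join_adj.2 (.inl hadj))
    · exact hI ha hb hab (graph_join_adj.2 (.inr (.inl hadj)))
  · rintro (⟨hsub, hI⟩ | ⟨hsub, hI⟩)
    · refine ⟨hsub.trans subset_union_left, fun a ha b hb hab hadj => ?_⟩
      have hnot : ∀ {c}, c ∈ I → c ∉ r.leaves := fun hc => disjoint_left.1 h (hsub hc)
      obtain hadj | hadj | ⟨-, hadj | hadj⟩ := graph_join_adj.1 hadj
      · exact hI ha hb hab hadj
      · exact hnot ha (mem_leaves_of_graph_adj hadj)
      · exact hnot hb hadj.2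
      · exact hnot ha hadj.2
    · refine ⟨hsub.trans subset_union_right, fun a ha b hb hab hadj => ?_⟩
      have hnot : ∀ {c}, c ∈ I → c ∉ l.leaves := fun hc => disjoint_right.1 h (hsub hc)
      obtain hadj | hadj | ⟨-, hadj | hadj⟩ := graph_join_adj.1 hadj
      · exact hnot ha (mem_leaves_of_graph_adj hadj)
      · exact hI ha hb hab hadj
      · exact hnot ha hadj.1
      · exact hnot hb hadj.1

theorem exists_isTokenPotential (hT : T.VertexDisjoint) :
    ∃ ψ, IsTokenPotential T.indepSets #T.leaves ψ := by
  induction T with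
  | leaf v => exact ⟨_, indepSets_leaf v ▸ isTokenPotential_Iic {v}⟩
  | union l r hl hr =>
    obtain ⟨ψ, hψ⟩ := hl hT.1
    obtain ⟨φ, hφ⟩ := hr hT.2.1
    have hdisj := disjoint_verts_iff.1 hT.2.2
    rw [indepSets_union hdisj, leaves, card_union_of_disjoint hdisj]
    exact ⟨_, hψ.sups l.isLowerSet_indepSets r.isLowerSet_indepSets l.indepSets_subset_Iic
      r.indepSets_subset_Iic hdisj hφ⟩
  | join l r hl hr =>
    obtain ⟨ψ, hψ⟩ := hl hT.1
    obtain ⟨φ, hφ⟩ := hr hT.2.1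
    have hdisj := disjoint_verts_iff.1 hT.2.2
    rw [indepSets_join hdisj, leaves, card_union_of_disjoint hdisj]
    exact exists_isTokenPotential_union l.isLowerSet_indepSets r.isLowerSet_indepSets
      (fun A hA B hB => hdisj.mono hA.1 hB.1) hψ hφ

end Cotree

section TAR

variable {G : SimpleGraph V}

theorem exists_isTokenPotential_of_isCograph [Fintype V] (hG : G.IsCograph) :
    ∃ ψ, IsTokenPotential {I : Finset V | G.IsIndepSet I} (Fintype.card V) ψ := by
  classical
  obtain ⟨T, hT, hverts, rfl⟩ := hG
  have hleaves : T.leaves = univ := by rw [← coe_eq_univ, T.coe_leaves, hverts]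
  have hindep : T.indepSets = {I : Finset V | T.graph.IsIndepSet I} := by
    simp only [Cotree.indepSets, hleaves, subset_univ, true_and]
  simpa only [hindep, hleaves, card_univ] using Cotree.exists_isTokenPotential hT

theorem exists_walk_length_eq_of_embedding {W W' : Type*} {H : SimpleGraph W}
    {H' : SimpleGraph W'} (f : H ↪g H') (hf : ∀ a b, H'.Adj (f a) b → b ∈ Set.range f) {a b : W}
    (w : H'.Walk (f a) (f b)) : ∃ p : H.Walk a b, p.length = w.length := by
  generalize hx : f a = x at w
  generalize hy : f b = y at w
  induction w generalizing a with
  | nil =>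
    obtain rfl := f.injective (hx.trans hy.symm)
    exact ⟨.nil, rfl⟩
  | cons hadj w ih =>
    subst hx
    obtain ⟨c, rfl⟩ := hf a _ hadj
    obtain ⟨p, hp⟩ := ih rfl hy
    exact ⟨.cons (f.map_adj_iff.1 hadj) p, congrArg (· + 1) hp⟩

variable [DecidableEq V] {k : ℤ} {n : ℕ} {ψ : Finset V → ℕ}

theorem TAR_adj_iff_hasse_adj (I J : G.TARVertex k) :
    (G.TAR k).Adj I J ↔ (SimpleGraph.hasse (Finset V)).Adj I.1 J.1 := by
  have hcov : ∀ {A B : Finset V}, A ⋖ B ↔ A ≠ B ∧ ∃ v, A ∪ {v} = B := by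
    intro A B
    simp only [covBy_iff_exists_insert, insert_eq, union_comm {_} A]
    constructor
    · rintro ⟨v, hv, rfl⟩
      exact ⟨fun h => hv (left_eq_union.1 h (mem_singleton_self v)), v, rfl⟩
    · rintro ⟨hne, v, rfl⟩
      exact ⟨v, fun hv => hne (left_eq_union.2 (singleton_subset_iff.2 hv)), rfl⟩
  rw [SimpleGraph.hasse_adj, hcov, hcov, ne_comm (a := J.1), ← and_or_left, ← exists_or]
  simp only [SimpleGraph.TAR, ne_eq, Subtype.ext_iff, eq_comm (b := J.1 ∪ _)]

/-- `TAR_k(G)` is the part of the reconfiguration graph of the independent sets of `G` that consists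
of the independent sets with at least `k` elements. -/
def tarEmbedding (G : SimpleGraph V) (k : ℤ) :
    G.TAR k ↪g tokenGraph {I : Finset V | G.IsIndepSet I} k.toNat where
  toFun := Subtype.val
  inj' := Subtype.val_injective
  map_rel_iff' := by
    intro I J
    rw [TAR_adj_iff_hasse_adj]
    exact ⟨fun h => h.2.2, fun h =>
      ⟨⟨I.2.1, Int.toNat_le.2 I.2.2⟩, ⟨J.2.1, Int.toNat_le.2 J.2.2⟩, h⟩⟩

theorem exists_walk_toSimpleGraph_length_le
    (hψ : IsTokenPotential {I : Finset V | G.IsIndepSet I} n ψ)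
    (C : (G.TAR k).ConnectedComponent) (I J : C) :
    ∃ w : C.toSimpleGraph.Walk I J, (w.length : ℤ) ≤ 4 * n - 4 * max k 0 := by
  let f : C.toSimpleGraph ↪g tokenGraph {I : Finset V | G.IsIndepSet I} k.toNat :=
    (tarEmbedding G k).comp (SimpleGraph.Embedding.induce C.supp)
  have hf : ∀ A B, (tokenGraph {I : Finset V | G.IsIndepSet I} k.toNat).Adj (f A) B →
      B ∈ Set.range f := fun A B h => by
    let B' : G.TARVertex k := ⟨B, h.2.1.1, Int.toNat_le.1 h.2.1.2⟩
    have hadj : (G.TAR k).Adj A.1 B' := (tarEmbedding G k).map_adj_iff.1 h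
    exact ⟨⟨B', C.mem_supp_of_adj_mem_supp A.2 hadj⟩, rfl⟩
  have hkI : k.toNat ≤ #(f I) := Int.toNat_le.2 I.1.2.2
  have hkJ : k.toNat ≤ #(f J) := Int.toNat_le.2 J.1.2.2
  have hreach : (tokenGraph _ k.toNat).Reachable (f I) (f J) :=
    (C.reachable_of_mem_supp I.2 J.2).map (tarEmbedding G k).toHom
  obtain ⟨w, hw⟩ := hψ.exists_walk_length_add_le (I := f I) I.1.2.1 hkI hreach
  obtain ⟨p, hp⟩ := exists_walk_length_eq_of_embedding f hf w
  exact ⟨p, by omega⟩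

end TAR

theorem mainTheorem7_general {V : Type*} [Fintype V] [DecidableEq V] (G : SimpleGraph V)
    (hG : G.IsCograph) (k : ℤ) (C : (G.TAR k).ConnectedComponent) :
    C.toSimpleGraph.ediam ≠ ⊤ ∧
      (C.toSimpleGraph.diam : ℤ) ≤ 4 * (Fintype.card V : ℤ) - 4 * max k 0 := by
  obtain ⟨ψ, hψ⟩ := exists_isTokenPotential_of_isCograph hG
  have hwalk := exists_walk_toSimpleGraph_length_le hψ C
  obtain ⟨d, hd⟩ : ∃ d : ℕ, (d : ℤ) = 4 * (Fintype.card V : ℤ) - 4 * max k 0 := by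
    obtain ⟨I, hI⟩ := C.nonempty_supp
    obtain ⟨w, hw⟩ := hwalk ⟨I, hI⟩ ⟨I, hI⟩
    exact Int.eq_ofNat_of_zero_le ((Int.natCast_nonneg _).trans hw) |>.imp fun _ => Eq.symm
  have hdiam : C.toSimpleGraph.ediam ≤ d := SimpleGraph.ediam_le_of_edist_le fun I J => by
    obtain ⟨w, hw⟩ := hwalk I J
    exact w.edist_le.trans (Nat.cast_le.2 (by omega))
  rw [← hd, Nat.cast_le]
  exact ⟨ne_top_of_le_ne_top (ENat.natCast_ne_top d) hdiam, ENat.toNat_le_of_le_natCast hdiam⟩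

theorem mainTheorem7 {V : Type*} [Fintype V] [DecidableEq V] (G : SimpleGraph V)
    (hG : G.IsCograph) (k : ℤ) (C : (G.TAR k).ConnectedComponent) :
    C.toSimpleGraph.ediam ≠ ⊤ ∧
      (C.toSimpleGraph.diam : ℤ) ≤ 4 * (Fintype.card V : ℤ) - 2 * k := by
  obtain ⟨hfin, hdiam⟩ := mainTheorem7_general G hG k C
  exact ⟨hfin, by omega⟩
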